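/- Let $K\in\{\mathbb R,\mathbb C\}$, let $n\ge 1$, let $K^n$ carry the Euclidean scalar product $\langle x,y\rangle=\sum_j x_j\overline{y_j}$, and let $(T,d)$ be a non-empty compact metric space with Borel $\sigma$-algebra $\mathcal B$. Let $cabv(K^n)$ be the space of $\sigma$-additive $\mu:\mathcal B\to K^n$ with finite total variation $\|\mu\|=|\mu|(T)$, and for $a>0$, $v\in K^n$ let $B_a(K^n,v)=\{\mu\in cabv(K^n):\|\mu\|\le a,\ \mu(T)=v\}$. For continuous $f:T\to K^n$ let $\int f\,d\mu$ be the (uniform, sesquilinear) integral extending $\int\sum_i\varphi_{A_i}x_i\,d\mu=\sum_i\langle x_i,\mu(A_i)\rangle$. The weak* topology on $cabv(K^n)$ is the coarsest one for which all maps $\mu\mapsto\int f\,d\mu$, $f\in C(T,K^n)$, are continuous (that is, the weak* topology of $C(T,K^n)'\equiv cabv(K^n)$). For a map $f$ between metric spaces let $\|f\|_L$ be its Lipschitz constant, the supremum of $d(f(x),f(y))/d(x,y)$ over $x\neq y$. For $\mu$ with $\mu(T)=0$ put $\|\mu\|^*_{MK}=\sup\{|\int f\,d\mu| : f:T\to K^n,\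 \|f\|_L\le 1\}$, and put $d^*_{MK}(\mu,\nu)=\|\mu-\nu\|^*_{MK}$. Let $M\ge1$, let $\omega_1,\dots,\omega_M:T\to T$ be Lipschitz maps with Lipschitz constants $r_i=\|\omega_i\|_L$, let $R_1,\dots,R_M$ be linear operators on $K^n$ with operator norms $\|R_i\|_o$, and define $H:cabv(K^n)\to cabv(K^n)$ by $H(\mu)(B)=\sum_{i=1}^M R_i(\mu(\omega_i^{-1}(B)))$. Assume $\sum_{i=1}^M R_i=\mathrm{Id}_{K^n}$ and put $c=\sum_{i=1}^M\|R_i\|_o r_i$. (1) Suppose $c<1$. Let $0<a<\infty$, $v\in K^n$ with $\|v\|\le a$, and let $\emptyset\ne A\subseteq B_a(K^n,v)$ be weak* closed with $H(A)\subseteq A$. Then $d^*_{MK}$ is a metric on $A$, the map $H_1:A\to A$, $H_1(\mu)=H(\mu)$, is a contraction of $(A,d^*_{MK})$ with contraction factor $\|H_1\|_L\le c$, and there is a unique $\mu^*\in A$ with $H_1(\mu^*)=\mu^*$. (2) If $r_i<1$ for all $i$ and $\sum_i\|R_i\|_o=1$, then $c<1$. (3) If $\|H(\mu)\|\le\|\mu\|$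 for all $\mu\in cabv(K^n)$, then for all $0<a<\infty$ and $v\in K^n$ with $\|v\|\le a$ one can take $A=B_a(K^n,v)$ in (1): this set is non-empty, weak* closed, and $H(B_a(K^n,v))\subseteq B_a(K^n,v)$. (4) If $\sum_i\|R_i\|_o=1$, then $\|H(\mu)\|\le\|\mu\|$ for all $\mu\in cabv(K^n)$. -/

import Mathlib

open MeasureTheory Set Topology
open scoped ENNReal

noncomputable section

namespace FractalVM

/-- The Lipschitz constant of `f`: the supremum (possibly `∞`) of
`d(f x, f y) / d(x, y)` over all `x ≠ y`. -/
def eLip {S Y : Type*} [MetricSpace S] [MetricSpace Y] (f : S → Y) : ℝ≥0∞ :=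
  ⨆ (x : S) (y : S) (_ : x ≠ y), edist (f x) (f y) / edist x y

/-- `f` is lipschitzian if its Lipschitz constant is finite. -/
def IsLip {S Y : Type*} [MetricSpace S] [MetricSpace Y] (f : S → Y) : Prop :=
  eLip f < ∞

/-- The Lipschitz constant of a lipschitzian function as a real number. -/
def lip {S Y : Type*} [MetricSpace S] [MetricSpace Y] (f : S → Y) : ℝ :=
  (eLip f).toReal

section

variable (𝕜 : Type*) [RCLike 𝕜] (T : Type*) [MetricSpace T] [MeasurableSpace T]
  (X : Type*) [NormedAddCommGroup X] [InnerProductSpace 𝕜 X]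

/-- The space of `σ`-additive `X`-valued measures on the Borel sets of `T` with
finite total variation. -/
def Cabv : Submodule 𝕜 (VectorMeasure T X) where
  carrier := {μ | μ.variation univ < ∞}
  zero_mem' := by simp
  add_mem' := by
    intro μ ν hμ hν
    refine lt_of_le_of_lt (VectorMeasure.variation_add_le univ) ?_
    simpa using And.intro hμ hν
  smul_mem' := by
    intro c μ hμ
    simp only [mem_ofPred_eq, VectorMeasure.variation_smul] at hμ ⊢
    simpa using ENNReal.mul_lt_top (by simp) hμ

end

variable {𝕜 : Type*} [RCLike 𝕜] {T : Type*} [MetricSpace T] [MeasurableSpace T]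
  {X : Type*} [NormedAddCommGroup X] [InnerProductSpace 𝕜 X]

/-- The variational norm `‖μ‖ = |μ|(T)`. -/
def varNorm (μ : Cabv 𝕜 T X) : ℝ := (μ.1.variation univ).toReal

/-- The set `B_a(X, v)` of measures with `‖μ‖ ≤ a` and `μ(T) = v`. -/
def ball (a : ℝ) (v : X) : Set (Cabv 𝕜 T X) := {μ | varNorm μ ≤ a ∧ μ.1 univ = v}

/-- The real bilinear map `(x, y) ↦ ⟨x, y⟩`, the scalar product of `X` written with the convention
that it is linear in `x` and antilinear in `y`. -/
def pairing (𝕜 : Type*) [RCLike 𝕜] (X : Type*) [NormedAddCommGroup X] [InnerProductSpace 𝕜 X]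
    [NormedSpace ℝ X] [IsScalarTower ℝ 𝕜 X] : X →L[ℝ] X →L[ℝ] 𝕜 :=
  ((isBoundedBilinearMap_inner (𝕜 := 𝕜) (E := X)).toContinuousLinearMap).flip

theorem pairing_apply [NormedSpace ℝ X] [IsScalarTower ℝ 𝕜 X] (x y : X) :
    pairing 𝕜 X x y = inner 𝕜 y x := rfl

/-- The sesquilinear integral `∫ f dμ`: on a simple function it is `∑ ⟨x_i, μ(A_i)⟩`. -/
def integ [NormedSpace ℝ X] [IsScalarTower ℝ 𝕜 X] (f : T → X) (μ : Cabv 𝕜 T X) : 𝕜 :=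
  μ.1.integral f (pairing 𝕜 X)

/-- The weak* topology on `Cabv`, coming from its identification `μ ↦ (f ↦ ∫ f dμ)` with the
dual of `C(T, X)`: the coarsest topology making all `μ ↦ ∫ f dμ`, `f` continuous, continuous. -/
@[reducible] def weakStar (𝕜 : Type*) [RCLike 𝕜] (T : Type*) [MetricSpace T] [MeasurableSpace T]
    (X : Type*) [NormedAddCommGroup X] [InnerProductSpace 𝕜 X]
    [NormedSpace ℝ X] [IsScalarTower ℝ 𝕜 X] : TopologicalSpace (Cabv 𝕜 T X) :=
  TopologicalSpace.induced (fun (μ : Cabv 𝕜 T X) (f : C(T, X)) => integ f μ)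
    Pi.topologicalSpace

/-- The modified Monge-Kantorovich norm, as an extended real: the supremum of `|∫ f dμ|` over the
functions `f : T → X` with Lipschitz constant at most `1`. It is used for `μ(T) = 0`. -/
def mkStar [NormedSpace ℝ X] [IsScalarTower ℝ 𝕜 X] (μ : Cabv 𝕜 T X) : ℝ≥0∞ :=
  ⨆ (f : T → X) (_ : eLip f ≤ 1), ‖integ f μ‖ₑ

/-- The distance `d*_MK(μ, ν) = ‖μ - ν‖*_MK`. -/
def dMKStar [NormedSpace ℝ X] [IsScalarTower ℝ 𝕜 X] (μ ν : Cabv 𝕜 T X) : ℝ≥0∞ :=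
  mkStar (μ - ν)

/-- The transported measure `B ↦ μ(h⁻¹(B))`, for continuous `h`. -/
def transport [BorelSpace T] (h : C(T, T)) (μ : Cabv 𝕜 T X) : Cabv 𝕜 T X :=
  ⟨μ.1.map h, by
    have : IsFiniteMeasure μ.1.variation := ⟨μ.2⟩
    exact measure_lt_top (μ.1.map h).variation univ⟩

/-- The measure `B ↦ R(μ(B))`, for a continuous linear `R`. -/
def push (R : X →L[𝕜] X) (μ : Cabv 𝕜 T X) : Cabv 𝕜 T X :=
  ⟨μ.1.mapRange R.toLinearMap.toAddMonoidHom R.continuous, by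
    refine lt_of_le_of_lt (VectorMeasure.variation_le_of_forall_enorm_le
      (m := ‖R‖₊ • μ.1.variation) (fun s _ => ?_) univ)
      (by simpa using ENNReal.mul_lt_top (by simp) μ.2)
    refine (R.le_opENorm (μ.1 s)).trans ?_
    simp only [Measure.smul_apply, Measure.nnreal_smul_coe_apply, enorm_eq_nnnorm]
    gcongr
    exact VectorMeasure.enorm_measure_le_variation _ _⟩

/-- A lipschitzian map is continuous. -/
theorem IsLip.continuous {S Y : Type*} [MetricSpace S] [MetricSpace Y] {f : S → Y}
    (hf : IsLip f) : Continuous f := by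
  have h : LipschitzWith (eLip f).toNNReal f := by
    intro x y
    rw [ENNReal.coe_toNNReal hf.ne]
    rcases eq_or_ne x y with rfl | hxy
    · simp
    · rw [← ENNReal.div_le_iff (by simpa using hxy) (edist_ne_top x y)]
      exact le_iSup_of_le x (le_iSup_of_le y (le_iSup_of_le hxy le_rfl))
  exact h.continuous

/-- The Markov-type operator `H(μ) = ∑ R_i ∘ ω_i(μ)`. -/
def markov [BorelSpace T] {M : ℕ} (ω : Fin M → T → T) (hω : ∀ i, IsLip (ω i))
    (R : Fin M → X →L[𝕜] X) (μ : Cabv 𝕜 T X) : Cabv 𝕜 T X :=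
  ∑ i, push (R i) (transport ⟨ω i, (hω i).continuous⟩ μ)

end FractalVM

end

/-!
On measures of total mass zero the norm `‖·‖*_MK` is finite, since subtracting a constant from a
Lipschitz integrand does not change the integral, and it separates points, since indicators of
closed sets are bounded limits of Lipschitz functions (`eq_zero_of_mkStar_eq_zero`). Hence `d*_MK`
is a metric on any set of measures with prescribed total mass (`mkMetricSpace`). The operator `H` is
dual to `f ↦ ∑ R_i† ∘ f ∘ ω_i`, which maps `1`-Lipschitz functions to `c`-Lipschitz functions; so `H`
contracts `d*_MK` by the factor `c` (`dMKStar_markov_le`), and the fixed point is given by Banach's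
theorem as soon as `A` is complete.

Completeness (`completeSpace_mkMetricSpace`) comes from weak* compactness of bounded sets: a weak*
limit of a Cauchy sequence along an ultrafilter lies in the weak* closed set `A`, and the norm is
weak* lower semicontinuous. For the compactness (`exists_tendsto_integ`), let `μ_k` be bounded, let
`ν` be the weak limit of the variations `|μ_k|` along the ultrafilter, and let `Φ f = lim ∫ f dμ_k`.
Then `|Φ f| ≤ ∫ ‖f‖ dν ≤ C ‖f‖_{L²(ν)}`, so that `Φ` extends to `L²(ν)` and the Fréchet-Riesz theorem
represents it by a density with respect to `ν`. This replaces the Riesz representation theorem for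
vector measures.

That `B_a(K^n, v)` is weak* closed follows from the formula `‖μ‖ = sup |∫ f dμ|` over the unit ball of
`C(T, K^n)` (`varNorm_le_of_forall_continuous`), which is obtained by `L¹(|μ|)`-approximation of step
functions.
-/

namespace FractalVM

open Filter NNReal

/-! ### The sesquilinear integral -/

section

theorem eLip_le_iff {S Y : Type*} [MetricSpace S] [MetricSpace Y] {f : S → Y} {K : ℝ≥0} :
    eLip f ≤ K ↔ LipschitzWith K f := by
  simp only [eLip, iSup_le_iff, LipschitzWith]
  refine forall₂_congr fun x y => ?_
  rcases eq_or_ne x y with rfl | hxy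
  · simp
  · rw [ENNReal.div_le_iff (by simpa using hxy) (edist_ne_top x y)]
    simp [hxy]

theorem IsLip.lipschitzWith {S Y : Type*} [MetricSpace S] [MetricSpace Y] {f : S → Y}
    (hf : IsLip f) : LipschitzWith (eLip f).toNNReal f := by
  rw [← eLip_le_iff, ENNReal.coe_toNNReal hf.ne]

/-- Induction principle for bounded measurable functions: a property that holds for indicators of
measurable sets and is stable under sums and bounded pointwise limits holds for every bounded
strongly measurable function. -/
theorem bounded_induction {T X : Type*} [MeasurableSpace T] [NormedAddCommGroup X]
    [NormedSpace ℝ X] {P : (T → X) → Prop}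
    (ind : ∀ (s : Set T) (x : X), MeasurableSet s → P (s.indicator fun _ => x))
    (add : ∀ f g : T → X, StronglyMeasurable f → StronglyMeasurable g →
      (∃ C : ℝ, ∀ t, ‖f t‖ ≤ C) → (∃ C : ℝ, ∀ t, ‖g t‖ ≤ C) → P f → P g → P (f + g))
    (lim : ∀ (F : ℕ → T → X) (f : T → X) (C : ℝ), (∀ k, StronglyMeasurable (F k)) →
      (∀ k t, ‖F k t‖ ≤ C) → (∀ t, Tendsto (fun k => F k t) atTop (𝓝 (f t))) →
      (∀ k, P (F k)) → P f)
    {f : T → X} (hf : StronglyMeasurable f) {C : ℝ} (hC : ∀ t, ‖f t‖ ≤ C) : P f := by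
  have hsimple : ∀ F : SimpleFunc T X, P F := by
    intro F
    induction F using SimpleFunc.induction with
    | @const c s hs =>
      convert! ind s c hs
    | @add F G _ hF hG =>
      exact add F G F.stronglyMeasurable G.stronglyMeasurable F.exists_forall_norm_le
        G.exists_forall_norm_le hF hG
  rcases isEmpty_or_nonempty T with hT | ⟨⟨t₀⟩⟩
  · rw [Subsingleton.elim f (0 : SimpleFunc T X)]
    exact hsimple 0
  refine lim (fun k => hf.approxBounded C k) f C (fun k => SimpleFunc.stronglyMeasurable _)
    (fun k t => hf.norm_approxBounded_le ((norm_nonneg _).trans (hC t₀)) k t)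
    (fun t => hf.tendsto_approxBounded_of_norm_le (hC t)) (fun k => hsimple _)

variable {𝕜 : Type*} [RCLike 𝕜] {T : Type*} [MeasurableSpace T]
  {X : Type*} [NormedAddCommGroup X] [InnerProductSpace 𝕜 X]

instance isFiniteMeasure_variation (μ : Cabv 𝕜 T X) : IsFiniteMeasure μ.1.variation := ⟨μ.2⟩

theorem integrable_of_bounded {μ : Cabv 𝕜 T X} {f : T → X} (hf : StronglyMeasurable f)
    (hC : ∃ C : ℝ, ∀ t, ‖f t‖ ≤ C) : μ.1.Integrable f :=
  let ⟨C, hC⟩ := hC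
  Integrable.of_bound hf.aestronglyMeasurable C (.of_forall hC)

variable [NormedSpace ℝ X] [IsScalarTower ℝ 𝕜 X]

theorem norm_pairing_le : ‖pairing 𝕜 X‖ ≤ 1 :=
  ContinuousLinearMap.opNorm_le_bound₂ _ zero_le_one fun x y => by
    simpa [pairing_apply, mul_comm] using norm_inner_le_norm (𝕜 := 𝕜) y x

theorem integ_add {μ : Cabv 𝕜 T X} {f g : T → X} (hf : μ.1.Integrable f) (hg : μ.1.Integrable g) :
    integ (f + g) μ = integ f μ + integ g μ :=
  VectorMeasure.integral_add hf hg

theorem integ_sub {μ : Cabv 𝕜 T X} {f g : T → X} (hf : μ.1.Integrable f) (hg : μ.1.Integrable g) :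
    integ (f - g) μ = integ f μ - integ g μ :=
  VectorMeasure.integral_sub hf hg

theorem integ_const (μ : Cabv 𝕜 T X) (x : X) : integ (fun _ => x) μ = inner 𝕜 (μ.1 univ) x := by
  rw [integ, VectorMeasure.integral_const, pairing_apply]

theorem integ_indicator (μ : Cabv 𝕜 T X) (x : X) {s : Set T} (hs : MeasurableSet s) :
    integ (s.indicator fun _ => x) μ = inner 𝕜 (μ.1 s) x := by
  rw [integ, VectorMeasure.integral_indicator_const _ hs, pairing_apply]

theorem norm_integ_le (μ : Cabv 𝕜 T X) (f : T → X) :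
    ‖integ f μ‖ ≤ ∫ t, ‖f t‖ ∂μ.1.variation :=
  (VectorMeasure.norm_integral_le_integral_norm).trans <|
    mul_le_of_le_one_left (by positivity) norm_pairing_le

theorem norm_integ_le_of_bound (μ : Cabv 𝕜 T X) {f : T → X} {C : ℝ} (hC : ∀ t, ‖f t‖ ≤ C) :
    ‖integ f μ‖ ≤ C * varNorm μ := by
  rcases isEmpty_or_nonempty T with hT | ⟨⟨t₀⟩⟩
  · simp [integ, varNorm, VectorMeasure.integral_of_isEmpty, univ_eq_empty_iff.2 hT]
  · refine (VectorMeasure.norm_integral_le_of_norm_le_const (.of_forall hC)).trans ?_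
    have hC0 : 0 ≤ C := (norm_nonneg _).trans (hC t₀)
    simp only [varNorm, Measure.real]
    gcongr
    exact mul_le_of_le_one_right hC0 norm_pairing_le

/-- Bounded convergence for the sesquilinear integral. -/
theorem tendsto_integ (μ : Cabv 𝕜 T X) {F : ℕ → T → X} {f : T → X} {C : ℝ}
    (hF : ∀ k, StronglyMeasurable (F k)) (hC : ∀ k t, ‖F k t‖ ≤ C)
    (hlim : ∀ t, Tendsto (fun k => F k t) atTop (𝓝 (f t))) :
    Tendsto (fun k => integ (F k) μ) atTop (𝓝 (integ f μ)) :=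
  VectorMeasure.tendsto_integral_of_dominated_convergence (fun _ => C)
    (fun k => (hF k).aestronglyMeasurable) (integrable_const _) (fun k => .of_forall (hC k))
    (.of_forall hlim)

theorem integ_smul (μ : Cabv 𝕜 T X) (c : 𝕜) {f : T → X} (hf : StronglyMeasurable f) {C : ℝ}
    (hC : ∀ t, ‖f t‖ ≤ C) : integ (c • f) μ = c * integ f μ := by
  refine bounded_induction (P := fun f => integ (c • f) μ = c * integ f μ) ?_ ?_ ?_ hf hC
  · intro s x hs
    have : (c • s.indicator fun _ => x) = s.indicator fun _ : T => c • x := by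
      ext t; by_cases ht : t ∈ s <;> simp [ht]
    rw [this, integ_indicator _ _ hs, integ_indicator _ _ hs, inner_smul_right]
  · intro f g hf hg hfC hgC h1 h2
    have hf' := integrable_of_bounded (μ := μ) hf hfC
    have hg' := integrable_of_bounded (μ := μ) hg hgC
    rw [smul_add, integ_add (hf'.smul c) (hg'.smul c), integ_add hf' hg', h1, h2, mul_add]
  · intro F f C hF hC hlim h
    refine tendsto_nhds_unique (tendsto_integ μ (C := ‖c‖ * C) (fun k => (hF k).const_smul c)
      (fun k t => ?_) fun t => (hlim t).const_smul c) ?_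
    · simpa [norm_smul] using mul_le_mul_of_nonneg_left (hC k t) (norm_nonneg c)
    · simpa only [h] using! (tendsto_integ μ hF hC hlim).const_mul c

theorem integ_push [CompleteSpace X] (μ : Cabv 𝕜 T X) (R : X →L[𝕜] X) {f : T → X}
    (hf : StronglyMeasurable f) {C : ℝ} (hC : ∀ t, ‖f t‖ ≤ C) :
    integ f (push R μ) = integ (fun t => R.adjoint (f t)) μ := by
  have hb {f : T → X} {C : ℝ} (hC : ∀ t, ‖f t‖ ≤ C) (t : T) :
      ‖R.adjoint (f t)‖ ≤ ‖R.adjoint‖ * C :=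
    (R.adjoint.le_opNorm _).trans (mul_le_mul_of_nonneg_left (hC t) (norm_nonneg _))
  refine bounded_induction
    (P := fun f => integ f (push R μ) = integ (fun t => R.adjoint (f t)) μ) ?_ ?_ ?_ hf hC
  · intro s x hs
    have : (fun t => R.adjoint (s.indicator (fun _ => x) t))
        = s.indicator fun _ : T => R.adjoint x := by
      ext t; by_cases ht : t ∈ s <;> simp [ht]
    rw [this, integ_indicator _ _ hs, integ_indicator _ _ hs,
      ContinuousLinearMap.adjoint_inner_right]
    rfl
  · intro f g hf hg hfC hgC h1 h2
    have h (f : T → X) (hf : StronglyMeasurable f) (hfC : ∃ C : ℝ, ∀ t, ‖f t‖ ≤ C) :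
        μ.1.Integrable (fun t => R.adjoint (f t)) :=
      integrable_of_bounded (R.adjoint.continuous.comp_stronglyMeasurable hf)
        (hfC.elim fun C hC => ⟨_, hb hC⟩)
    rw [integ_add (integrable_of_bounded hf hfC) (integrable_of_bounded hg hgC), h1, h2,
      ← integ_add (h f hf hfC) (h g hg hgC)]
    congr 1
    ext t : 1
    simp
  · intro F f C hF hC hlim h
    refine tendsto_nhds_unique ((tendsto_integ (push R μ) hF hC hlim).congr h)
      (tendsto_integ μ (fun k => R.adjoint.continuous.comp_stronglyMeasurable (hF k))
        (fun k t => hb (hC k) t) fun t => (R.adjoint.continuous.tendsto _).comp (hlim t))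

theorem integ_transport [MetricSpace T] [BorelSpace T] (μ : Cabv 𝕜 T X) (h : C(T, T)) {f : T → X}
    (hf : StronglyMeasurable f) (hC : ∃ C : ℝ, ∀ t, ‖f t‖ ≤ C) :
    integ f (transport h μ) = integ (f ∘ h) μ := by
  refine VectorMeasure.integral_map h.continuous.measurable hf.aestronglyMeasurable ?_
  exact integrable_of_bounded (hf.comp_measurable h.continuous.measurable)
    (hC.elim fun C hC => ⟨C, fun t => hC _⟩)

theorem integ_sub_measure {μ ν : Cabv 𝕜 T X} {f : T → X} (hμ : μ.1.Integrable f)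
    (hν : ν.1.Integrable f) : integ f (μ - ν) = integ f μ - integ f ν :=
  VectorMeasure.integral_sub_vectorMeasure hμ hν

theorem integ_sum_measure {ι : Type*} (s : Finset ι) (μ : ι → Cabv 𝕜 T X) {f : T → X}
    (hf : ∀ i, (μ i).1.Integrable f) : integ f (∑ i ∈ s, μ i) = ∑ i ∈ s, integ f (μ i) := by
  have : (∑ i ∈ s, μ i : Cabv 𝕜 T X).1 = ∑ i ∈ s, (μ i).1 := by simp
  rw [integ, this]
  exact VectorMeasure.integral_finsetSum_vectorMeasure fun i _ => hf i

end

/-! ### The Monge-Kantorovich norm -/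

section

theorem exists_bound {T X : Type*} [TopologicalSpace T] [CompactSpace T] [NormedAddCommGroup X]
    {f : T → X} (hf : Continuous f) : ∃ C : ℝ, ∀ t, ‖f t‖ ≤ C :=
  let ⟨C, hC⟩ := isCompact_univ.exists_bound_of_continuousOn hf.continuousOn
  ⟨C, fun t => hC t trivial⟩

variable {𝕜 : Type*} [RCLike 𝕜] {T : Type*} [MetricSpace T] [MeasurableSpace T]
  {X : Type*} [NormedAddCommGroup X] [InnerProductSpace 𝕜 X]

theorem integrable_of_continuous [CompactSpace T] [BorelSpace T] {f : T → X} (hf : Continuous f) (μ : Cabv 𝕜 T X) :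
    μ.1.Integrable f :=
  integrable_of_bounded hf.stronglyMeasurable (exists_bound hf)

variable [NormedSpace ℝ X] [IsScalarTower ℝ 𝕜 X]

/-- Homogeneity of the Monge-Kantorovich norm in the integrand. For `K = 0` the integrand is
constant, and the hypothesis `μ(T) = 0` is what makes the integral vanish. -/
theorem enorm_integ_le_mul_mkStar {μ : Cabv 𝕜 T X} (hμ : μ.1 univ = 0) {K : ℝ≥0} {f : T → X}
    (hf : LipschitzWith K f) : ‖integ f μ‖ₑ ≤ K * mkStar μ := by
  rcases eq_or_ne K 0 with rfl | hK
  · rcases isEmpty_or_nonempty T with hT | ⟨⟨t₀⟩⟩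
    · simp [integ, VectorMeasure.integral_of_isEmpty]
    have : f = fun _ => f t₀ := by
      ext1 t
      simpa using hf t t₀
    rw [this, integ_const, hμ, inner_zero_left]
    simp
  have hg : LipschitzWith 1 (fun t => (K⁻¹ : ℝ≥0) • f t) := by
    refine LipschitzWith.of_dist_le_mul fun s t => ?_
    rw [NNReal.smul_def, NNReal.smul_def, dist_smul₀, Real.norm_of_nonneg (by positivity),
      NNReal.coe_inv, inv_mul_le_iff₀ (by positivity), NNReal.coe_one, one_mul]
    exact hf.dist_le_mul s t
  have h1 : integ f μ = (K : ℝ) • integ (fun t => (K⁻¹ : ℝ≥0) • f t) μ := by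
    rw [integ, integ, ← VectorMeasure.integral_fun_smul]
    congr 1
    ext1 t
    rw [← NNReal.smul_def, smul_smul, mul_inv_cancel₀ hK, one_smul]
  rw [h1, enorm_smul]
  gcongr
  · simp
  · exact le_iSup₂_of_le _ (eLip_le_iff.2 (by simpa using hg)) le_rfl

variable [CompactSpace T] [BorelSpace T]

/-- On measures of total mass zero the Monge-Kantorovich norm is finite: an integrand may be
normalised to vanish at a point, and is then bounded by the diameter of `T`. -/
theorem mkStar_le_of_univ_eq_zero {μ : Cabv 𝕜 T X} (hμ : μ.1 univ = 0) :
    mkStar μ ≤ ENNReal.ofReal (Metric.diam (univ : Set T) * varNorm μ) := by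
  refine iSup₂_le fun f hf => ?_
  have hf : LipschitzWith 1 f := eLip_le_iff.1 hf
  rcases isEmpty_or_nonempty T with hT | ⟨⟨t₀⟩⟩
  · simp [integ, VectorMeasure.integral_of_isEmpty]
  have h : integ f μ = integ (f - fun _ => f t₀) μ := by
    rw [integ_sub (integrable_of_continuous hf.continuous μ)
      (integrable_of_continuous continuous_const μ), integ_const, hμ, inner_zero_left, sub_zero]
  rw [h, ← ofReal_norm]
  refine ENNReal.ofReal_le_ofReal (norm_integ_le_of_bound μ fun t => ?_)
  rw [Pi.sub_apply, ← dist_eq_norm]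
  refine (hf.dist_le_mul t t₀).trans ?_
  rw [NNReal.coe_one, one_mul]
  exact Metric.dist_le_diam_of_mem isCompact_univ.isBounded trivial trivial

/-- The Monge-Kantorovich norm separates points: the indicator of a closed set is a bounded limit
of Lipschitz functions, and the closed sets are a generating `π`-system. -/
theorem eq_zero_of_mkStar_eq_zero {μ : Cabv 𝕜 T X} (hμ : μ.1 univ = 0) (h : mkStar μ = 0) :
    μ = 0 := by
  have hint (K : ℝ≥0) (f : T → X) (hf : LipschitzWith K f) : integ f μ = 0 := by
    simpa [h] using enorm_integ_le_mul_mkStar hμ hf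
  have hclosed (F : Set T) (hF : IsClosed F) : μ.1 F = 0 := by
    obtain ⟨u, -, hu_pos, hu⟩ := exists_seq_strictAnti_tendsto (0 : ℝ)
    rw [← inner_self_eq_zero (𝕜 := 𝕜), ← integ_indicator μ (μ.1 F) hF.measurableSet]
    refine tendsto_nhds_unique (tendsto_integ μ (C := ‖μ.1 F‖)
      (F := fun k t => thickenedIndicator (hu_pos k) F t • μ.1 F) (fun k => ?_) (fun k t => ?_)
      fun t => ?_) (tendsto_const_nhds.congr fun k => (hint ((u k).toNNReal⁻¹ * ‖μ.1 F‖₊) _ ?_).symm)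
    · exact ((thickenedIndicator (hu_pos k) F).continuous.smul
        continuous_const).stronglyMeasurable
    · rw [NNReal.smul_def, norm_smul, Real.norm_of_nonneg (by positivity)]
      exact mul_le_of_le_one_left (norm_nonneg _) (mod_cast thickenedIndicator_le_one _ _ _)
    · have := tendsto_pi_nhds.1 (thickenedIndicator_tendsto_indicator_closure hu_pos hu F) t
      have := this.smul_const (μ.1 F)
      rw [hF.closure_eq] at this
      convert! this using 2
      by_cases ht : t ∈ F <;> simp [ht]
    · refine LipschitzWith.of_dist_le_mul fun s t => ?_
      rw [dist_eq_norm, NNReal.smul_def, NNReal.smul_def, ← sub_smul, norm_smul,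
        NNReal.coe_mul, coe_nnnorm, mul_right_comm]
      gcongr
      exact (lipschitzWith_thickenedIndicator (hu_pos k) F).dist_le_mul s t
  refine Subtype.ext (VectorMeasure.ext fun s hs => ?_)
  induction s, hs using MeasurableSpace.induction_on_inter
    ((BorelSpace.measurable_eq (α := T)).trans borel_eq_generateFrom_isClosed)
    isPiSystem_isClosed with
  | empty => simp
  | basic s hs => simpa using hclosed s hs
  | compl s hs ih =>
    have := VectorMeasure.of_add_of_sdiff (v := μ.1) hs MeasurableSet.univ (subset_univ s)
    rw [hμ] at this
    rw [compl_eq_univ_sdiff]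
    simp_all
  | iUnion s hd hs ih =>
    rw [(μ.1.hasSum_of_disjoint_iUnion (fun i => hs i) hd).tsum_eq.symm]
    simp_all

end

/-! ### The total variation as a dual norm -/

section

variable {𝕜 : Type*} [RCLike 𝕜] {T : Type*} [MetricSpace T] [CompactSpace T] [MeasurableSpace T]
  [BorelSpace T] {X : Type*} [NormedAddCommGroup X] [InnerProductSpace 𝕜 X]
  [NormedSpace ℝ X] [IsScalarTower ℝ 𝕜 X]

/-- The radial retraction onto the closed unit ball is `2`-Lipschitz at points of the ball. -/
theorem norm_sub_radial_le {X : Type*} [NormedAddCommGroup X] [NormedSpace ℝ X] {x y : X}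
    (hy : ‖y‖ ≤ 1) : ‖y - (max 1 ‖x‖)⁻¹ • x‖ ≤ 2 * ‖y - x‖ := by
  have h1 : ‖x - (max 1 ‖x‖)⁻¹ • x‖ ≤ ‖y - x‖ := by
    have h : x - (max 1 ‖x‖)⁻¹ • x = (1 - (max 1 ‖x‖)⁻¹) • x := by rw [sub_smul, one_smul]
    rcases le_total ‖x‖ 1 with hx | hx
    · simp [max_eq_left hx]
    · have hx0 : 0 < ‖x‖ := zero_lt_one.trans_le hx
      rw [h, max_eq_right hx, norm_smul, Real.norm_of_nonneg (by simpa using inv_le_one_of_one_le₀ hx),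
        sub_mul, inv_mul_cancel₀ hx0.ne', one_mul]
      have := norm_sub_norm_le x y
      rw [norm_sub_rev] at this
      linarith
  calc ‖y - (max 1 ‖x‖)⁻¹ • x‖ = ‖(y - x) + (x - (max 1 ‖x‖)⁻¹ • x)‖ := by congr 1; abel
    _ ≤ _ := (norm_add_le _ _).trans (by linarith)

/-- Bounds of a vector measure on the unit ball of `C(T, X)` extend to the bounded measurable
functions of sup norm at most `1`: these are `L¹(|μ|)`-limits of continuous ones, which can be
retracted radially into the unit ball. -/
theorem norm_integ_le_of_forall_continuous {μ : Cabv 𝕜 T X} {a : ℝ}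
    (h : ∀ f : C(T, X), (∀ t, ‖f t‖ ≤ 1) → ‖integ f μ‖ ≤ a) {g : T → X}
    (hg : StronglyMeasurable g) (hg1 : ∀ t, ‖g t‖ ≤ 1) : ‖integ g μ‖ ≤ a := by
  refine le_of_forall_pos_le_add fun ε hε => ?_
  have hgi : Integrable g μ.1.variation := integrable_of_bounded hg ⟨1, hg1⟩
  obtain ⟨φ, hφ, hφi⟩ := hgi.exists_boundedContinuous_integral_sub_le (half_pos hε)
  let f : C(T, X) := ⟨fun t => (max 1 ‖φ t‖)⁻¹ • φ t,
    ((continuous_const.max φ.continuous.norm).inv₀ fun t =>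
      (zero_lt_one.trans_le (le_max_left _ _)).ne').smul φ.continuous⟩
  have hf1 (t : T) : ‖f t‖ ≤ 1 := by
    have h0 : 0 < max 1 ‖φ t‖ := zero_lt_one.trans_le (le_max_left _ _)
    simp only [f, ContinuousMap.coe_mk]
    rw [norm_smul, norm_inv, Real.norm_of_nonneg h0.le, inv_mul_le_one₀ h0]
    exact le_max_right _ _
  have hfi := integrable_of_continuous f.continuous μ
  have h2 : ‖integ (g - ⇑f) μ‖ ≤ ε := by
    calc ‖integ (g - ⇑f) μ‖ ≤ ∫ t, ‖g t - f t‖ ∂μ.1.variation := norm_integ_le μ _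
      _ ≤ ∫ t, 2 * ‖g t - φ t‖ ∂μ.1.variation :=
        integral_mono (hgi.sub hfi).norm ((hgi.sub hφi).norm.const_mul 2)
          fun t => norm_sub_radial_le (hg1 t)
      _ ≤ ε := by rw [integral_const_mul]; linarith
  rw [integ_sub hgi hfi] at h2
  calc ‖integ g μ‖ = ‖integ f μ + (integ g μ - integ f μ)‖ := by congr 1; abel
    _ ≤ a + ε := (norm_add_le _ _).trans (add_le_add (h f hf1) h2)

/-- The total variation is the norm of the functional `f ↦ ∫ f dμ` on `C(T, X)`. Only the
inequality that is not elementary is stated: for a finite disjoint family of sets the integrand is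
the unit vector in direction `μ(A)` on each member `A`. -/
theorem varNorm_le_of_forall_continuous {μ : Cabv 𝕜 T X} {a : ℝ}
    (h : ∀ f : C(T, X), (∀ t, ‖f t‖ ≤ 1) → ‖integ f μ‖ ≤ a) : varNorm μ ≤ a := by
  have ha : 0 ≤ a := (norm_nonneg _).trans (h 0 (by simp))
  refine ENNReal.toReal_le_of_le_ofReal ha (le_of_not_gt fun hlt => ?_)
  obtain ⟨P, -, hd, hm, hP⟩ := μ.1.exists_lt_sum_of_lt_variation MeasurableSet.univ hlt
  let u : Set T → X := fun p => ((‖μ.1 p‖⁻¹ : ℝ) : 𝕜) • μ.1 p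
  have hu (p : Set T) : ‖u p‖ ≤ 1 := by
    simpa [u, norm_smul] using inv_mul_le_one
  let g : T → X := fun t => ∑ p ∈ P, p.indicator (fun _ => u p) t
  have hms (p : Set T) (hp : p ∈ P) : StronglyMeasurable (p.indicator fun _ => u p) :=
    stronglyMeasurable_const.indicator (hm p hp)
  have hg : StronglyMeasurable g := Finset.stronglyMeasurable_fun_sum P hms
  have hg1 (t : T) : ‖g t‖ ≤ 1 := by
    by_cases ht : ∃ p ∈ P, t ∈ p
    · obtain ⟨p, hp, htp⟩ := ht
      have : g t = u p := by
        refine (Finset.sum_eq_single_of_mem p hp fun q hq hqp => ?_).trans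
          (indicator_of_mem htp _)
        exact indicator_of_notMem (fun htq => (hd hq hp hqp).le_bot ⟨htq, htp⟩) _
      rw [this]
      exact hu p
    · have : g t = 0 := Finset.sum_eq_zero fun p hp => indicator_of_notMem (fun h => ht ⟨p, hp, h⟩) _
      simp [this]
  have hint : integ g μ = ((∑ p ∈ P, ‖μ.1 p‖ : ℝ) : 𝕜) := by
    have : integ g μ = ∑ p ∈ P, integ (p.indicator fun _ => u p) μ :=
      VectorMeasure.integral_finsetSum P fun p hp => integrable_of_bounded (hms p hp)
        ⟨1, fun t => (norm_indicator_le_norm_self _ _).trans (hu p)⟩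
    rw [this, RCLike.ofReal_sum]
    refine Finset.sum_congr rfl fun p hp => ?_
    rw [integ_indicator _ _ (hm p hp), inner_smul_right, inner_self_eq_norm_sq_to_K]
    rcases eq_or_ne (‖μ.1 p‖) 0 with h0 | h0
    · simp [h0]
    · norm_cast
      field_simp
  have hle := norm_integ_le_of_forall_continuous h hg hg1
  rw [hint, RCLike.norm_ofReal, abs_of_nonneg (by positivity)] at hle
  refine hP.not_ge ?_
  calc ∑ p ∈ P, ‖μ.1 p‖ₑ = ENNReal.ofReal (∑ p ∈ P, ‖μ.1 p‖) := by
        rw [ENNReal.ofReal_sum_of_nonneg fun _ _ => norm_nonneg _]; simp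
    _ ≤ _ := ENNReal.ofReal_le_ofReal hle

end

/-! ### Riesz representation and weak* compactness -/

section

section density

variable {𝕜 : Type*} [RCLike 𝕜] {T : Type*} [MeasurableSpace T]
  {X : Type*} [NormedAddCommGroup X] [InnerProductSpace 𝕜 X]
  [NormedSpace ℝ X] [CompleteSpace X]

variable (𝕜) in
/-- The vector measure of density `g` with respect to `ν`, as an element of `Cabv`. -/
noncomputable def ofDensity (ν : Measure T) {g : T → X} (hg : Integrable g ν) : Cabv 𝕜 T X :=
  ⟨ν.withDensityᵥ g, by
    change (ν.withDensityᵥ g).variation univ < ∞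
    rw [Measure.variation_withDensityᵥ hg, withDensity_apply _ MeasurableSet.univ,
      Measure.restrict_univ]
    exact hg.2⟩

theorem integ_ofDensity [IsScalarTower ℝ 𝕜 X] {ν : Measure T} {g : T → X} (hg : Integrable g ν)
    {f : T → X} (hf : StronglyMeasurable f) {C : ℝ} (hC : ∀ t, ‖f t‖ ≤ C) :
    integ f (ofDensity 𝕜 ν hg) = ∫ t, inner 𝕜 (g t) (f t) ∂ν := by
  have hint {f : T → X} {C : ℝ} (hf : StronglyMeasurable f) (hC : ∀ t, ‖f t‖ ≤ C) :
      Integrable (fun t => inner 𝕜 (g t) (f t)) ν :=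
    (hg.norm.mul_const C).mono' (hg.1.inner hf.aestronglyMeasurable) <| .of_forall fun t =>
      (norm_inner_le_norm _ _).trans (mul_le_mul_of_nonneg_left (hC t) (norm_nonneg _))
  refine bounded_induction
    (P := fun f => integ f (ofDensity 𝕜 ν hg) = ∫ t, inner 𝕜 (g t) (f t) ∂ν) ?_ ?_ ?_ hf hC
  · intro s x hs
    have h1 : (fun t => inner 𝕜 (g t) (s.indicator (fun _ => x) t))
        = s.indicator fun t => inner 𝕜 (g t) x := by
      ext t; by_cases ht : t ∈ s <;> simp [ht]
    rw [integ_indicator _ _ hs, h1, integral_indicator hs, ← inner_conj_symm]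
    change (starRingEnd 𝕜) (inner 𝕜 x (ν.withDensityᵥ g s)) = _
    rw [withDensityᵥ_apply hg hs, ← integral_inner hg.integrableOn, ← integral_conj]
    simp
  · rintro f₁ f₂ hf₁ hf₂ ⟨C₁, hC₁⟩ ⟨C₂, hC₂⟩ h₁ h₂
    rw [integ_add (integrable_of_bounded hf₁ ⟨C₁, hC₁⟩) (integrable_of_bounded hf₂ ⟨C₂, hC₂⟩),
      h₁, h₂, ← integral_add (hint hf₁ hC₁) (hint hf₂ hC₂)]
    simp [inner_add_right]
  · intro F f C hF hC hlim h
    refine tendsto_nhds_unique ((tendsto_integ _ hF hC hlim).congr h) ?_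
    refine tendsto_integral_of_dominated_convergence (fun t => ‖g t‖ * C)
      (fun k => hg.1.inner (hF k).aestronglyMeasurable) (hg.norm.mul_const C)
      (fun k => .of_forall fun t => (norm_inner_le_norm _ _).trans
        (mul_le_mul_of_nonneg_left (hC k t) (norm_nonneg _)))
      (.of_forall fun t => tendsto_const_nhds.inner (hlim t))

end density

variable {𝕜 : Type*} [RCLike 𝕜] {T : Type*} [MetricSpace T] [CompactSpace T] [MeasurableSpace T]
  [BorelSpace T] {X : Type*} [NormedAddCommGroup X] [InnerProductSpace 𝕜 X]
  [NormedSpace ℝ X] [IsScalarTower ℝ 𝕜 X] [CompleteSpace X]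

/-- Riesz representation for functionals dominated by a positive measure `ν`: the functional is
bounded for the `L²(ν)` norm, so that the Fréchet-Riesz theorem provides a density. -/
theorem exists_integ_eq_of_dominated (ν : Measure T) [IsFiniteMeasure ν] (Φ : C(T, X) →ₗ[𝕜] 𝕜)
    (hΦ : ∀ f, ‖Φ f‖ ≤ ∫ t, ‖f t‖ ∂ν) : ∃ μ : Cabv 𝕜 T X, ∀ f : C(T, X), Φ f = integ f μ := by
  let e : C(T, X) →L[𝕜] Lp X 2 ν := ContinuousMap.toLp 2 ν 𝕜
  have hdense : DenseRange e.toLinearMap :=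
    ContinuousMap.toLp_denseRange X ν 𝕜 (by simp)
  have hbound : ∃ C, ∀ f, ‖Φ f‖ ≤ C * ‖e.toLinearMap f‖ := by
    -- Hölder's inequality between `L¹(ν)` and `L²(ν)`.
    refine ⟨(ν univ ^ (1 / (1 : ℝ≥0∞).toReal - 1 / (2 : ℝ≥0∞).toReal)).toReal, fun f =>
      (hΦ f).trans ?_⟩
    have hfm : AEStronglyMeasurable f ν := f.continuous.aestronglyMeasurable
    have h1 : ∫ t, ‖f t‖ ∂ν = (eLpNorm f 1 ν).toReal := by
      rw [integral_norm_eq_lintegral_enorm hfm, eLpNorm_one_eq_lintegral_enorm]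
    have h2 : ‖e.toLinearMap f‖ = (eLpNorm f 2 ν).toReal := by
      change ‖e f‖ = _
      rw [Lp.norm_def, eLpNorm_congr_ae (ContinuousMap.coeFn_toLp ν f)]
    have hfin : eLpNorm f 2 ν ≠ ∞ := by
      rw [← eLpNorm_congr_ae (ContinuousMap.coeFn_toLp (p := 2) (𝕜 := 𝕜) ν f)]
      exact Lp.eLpNorm_ne_top _
    rw [h1, h2, mul_comm, ← ENNReal.toReal_mul]
    refine ENNReal.toReal_mono (ENNReal.mul_ne_top hfin
      (ENNReal.rpow_ne_top_of_nonneg (by norm_num) (measure_ne_top _ _))) ?_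
    exact eLpNorm_le_eLpNorm_mul_rpow_measure_univ (by norm_num) hfm
  let g : Lp X 2 ν := (InnerProductSpace.toDual 𝕜 (Lp X 2 ν)).symm (Φ.extendOfNorm e.toLinearMap)
  have hg : Integrable g ν := (Lp.memLp g).integrable (by norm_num)
  refine ⟨ofDensity 𝕜 ν hg, fun f => ?_⟩
  obtain ⟨C, hC⟩ := exists_bound f.continuous
  rw [integ_ofDensity hg f.continuous.stronglyMeasurable hC,
    ← LinearMap.extendOfNorm_eq hdense hbound f,
    ← InnerProductSpace.toDual_symm_apply, L2.inner_def]
  refine integral_congr_ae ?_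
  filter_upwards [ContinuousMap.coeFn_toLp (p := 2) (𝕜 := 𝕜) ν f] with t ht
  exact congrArg (inner 𝕜 (g t)) ht

/-- Weak* compactness of bounded sets of vector measures, stated along an ultrafilter. The
variations converge weakly to some `ν` along it, and `ν` dominates the limit functional. -/
theorem exists_tendsto_integ {ι : Type*} (U : Ultrafilter ι) (μ : ι → Cabv 𝕜 T X) {a : ℝ}
    (ha : ∀ i, varNorm (μ i) ≤ a) :
    ∃ μ' : Cabv 𝕜 T X, ∀ f : C(T, X),
      Tendsto (fun i => integ f (μ i)) U (𝓝 (integ f μ')) := by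
  let V : ι → FiniteMeasure T := fun i => ⟨(μ i).1.variation, inferInstance⟩
  have hV (i : ι) : V i ∈ {ν : FiniteMeasure T | ν.mass ≤ a.toNNReal} := by
    have : (V i).mass = (varNorm (μ i)).toNNReal := (Real.toNNReal_coe (r := (V i).mass)).symm
    change (V i).mass ≤ _
    rw [this]
    exact Real.toNNReal_le_toNNReal (ha i)
  obtain ⟨ν, -, hν⟩ := (isCompact_setOfPred_finiteMeasure_le_of_compactSpace T
    a.toNNReal).ultrafilter_le_nhds (U.map V) (by
      simp only [Ultrafilter.coe_map, le_principal_iff, mem_map]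
      exact Eventually.of_forall (f := (U : Filter ι)) hV)
  have hν : Tendsto V U (𝓝 ν) := hν
  have hex (f : C(T, X)) : ∃ z : 𝕜, Tendsto (fun i => integ f (μ i)) U (𝓝 z) := by
    obtain ⟨z, -, hz⟩ := (isCompact_closedBall (0 : 𝕜) (‖f‖ * a)).ultrafilter_le_nhds
      (U.map fun i => integ f (μ i)) (by
        simp only [Ultrafilter.coe_map, le_principal_iff, mem_map]
        refine Eventually.of_forall (f := (U : Filter ι)) fun i => ?_
        simpa using (norm_integ_le_of_bound (μ i) f.norm_coe_le_norm).trans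
          (mul_le_mul_of_nonneg_left (ha i) (norm_nonneg _)))
    exact ⟨z, hz⟩
  choose Φ hΦ using hex
  let Φ' : C(T, X) →ₗ[𝕜] 𝕜 :=
    { toFun := Φ
      map_add' := fun f g => tendsto_nhds_unique (hΦ _) <| ((hΦ f).add (hΦ g)).congr fun i =>
        (integ_add (integrable_of_continuous f.continuous _)
          (integrable_of_continuous g.continuous _)).symm
      map_smul' := fun c f => tendsto_nhds_unique (hΦ _) <| ((hΦ f).const_mul c).congr fun i =>
        (integ_smul (μ i) c f.continuous.stronglyMeasurable f.norm_coe_le_norm).symm }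
  obtain ⟨μ', hμ'⟩ := exists_integ_eq_of_dominated (ν : Measure T) Φ' fun f => by
    let φ : BoundedContinuousFunction T ℝ :=
      BoundedContinuousFunction.mkOfCompact ⟨fun t => ‖f t‖, f.continuous.norm⟩
    have := FiniteMeasure.tendsto_iff_forall_integral_tendsto.1 hν φ
    exact le_of_tendsto_of_tendsto (hΦ f).norm this
      (.of_forall fun i => norm_integ_le (μ i) f)
  exact ⟨μ', fun f => by simpa only [← hμ' f] using! hΦ f⟩

end

/-! ### The operator `H`, the balls `B_a(X, v)` and completeness -/

section

/-- Point masses show that `B_a(X, v)` is non-empty. -/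
theorem nonempty_ball {𝕜 T X : Type*} [RCLike 𝕜] [MeasurableSpace T] [Nonempty T]
    [NormedAddCommGroup X] [InnerProductSpace 𝕜 X] {a : ℝ} {v : X} (h : ‖v‖ ≤ a) :
    (ball a v : Set (Cabv 𝕜 T X)).Nonempty := by
  obtain ⟨t⟩ := ‹Nonempty T›
  refine ⟨⟨VectorMeasure.dirac t v, measure_lt_top _ _⟩, ?_, ?_⟩
  · simpa [varNorm] using h
  · simp

variable {𝕜 : Type*} [RCLike 𝕜] {T : Type*} [MetricSpace T] [MeasurableSpace T]
  [BorelSpace T] {X : Type*} [NormedAddCommGroup X] [InnerProductSpace 𝕜 X]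

section markov

variable {M : ℕ} {ω : Fin M → T → T} {hω : ∀ i, IsLip (ω i)} {R : Fin M → X →L[𝕜] X}

theorem markov_apply (μ : Cabv 𝕜 T X) {s : Set T} (hs : MeasurableSet s) :
    (markov ω hω R μ).1 s = ∑ i, R i (μ.1 (ω i ⁻¹' s)) := by
  have h : (markov ω hω R μ).1
      = ∑ i, (push (R i) (transport ⟨ω i, (hω i).continuous⟩ μ)).1 := by
    simp [markov]
  have hi (i : Fin M) : (push (R i) (transport ⟨ω i, (hω i).continuous⟩ μ)).1 s
      = R i (μ.1 (ω i ⁻¹' s)) := by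
    change R i ((μ.1.map (ω i)) s) = _
    rw [VectorMeasure.map_apply _ (hω i).continuous.measurable hs]
  rw [h, FunLike.coe_sum, Finset.sum_apply]
  exact Finset.sum_congr rfl fun i _ => hi i

theorem varNorm_markov_le (μ : Cabv 𝕜 T X) :
    varNorm (markov ω hω R μ) ≤ (∑ i, ‖R i‖) * varNorm μ := by
  have h : (markov ω hω R μ).1.variation ≤ ∑ i, ‖R i‖₊ • μ.1.variation.map (ω i) := by
    refine VectorMeasure.variation_le_of_forall_enorm_le fun s hs => ?_
    rw [markov_apply μ hs, Measure.finsetSum_apply]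
    refine (enorm_sum_le _ _).trans (Finset.sum_le_sum fun i _ => ?_)
    rw [Measure.smul_apply, Measure.map_apply (hω i).continuous.measurable hs]
    refine ((R i).le_opENorm _).trans ?_
    rw [enorm_eq_nnnorm, ENNReal.smul_def, smul_eq_mul]
    gcongr
    exact VectorMeasure.enorm_measure_le_variation _ _
  have h1 := h univ
  rw [Measure.finsetSum_apply] at h1
  refine ENNReal.toReal_le_of_le_ofReal (by simp only [varNorm]; positivity) (h1.trans_eq ?_)
  rw [ENNReal.ofReal_mul (by positivity), varNorm, ENNReal.ofReal_toReal (measure_ne_top _ _),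
    ENNReal.ofReal_sum_of_nonneg fun _ _ => norm_nonneg _, Finset.sum_mul]
  refine Finset.sum_congr rfl fun i _ => ?_
  rw [Measure.smul_apply, Measure.map_apply (hω i).continuous.measurable MeasurableSet.univ,
    preimage_univ, ENNReal.smul_def, smul_eq_mul, ofReal_norm, enorm_eq_nnnorm]

variable [CompactSpace T] [NormedSpace ℝ X] [IsScalarTower ℝ 𝕜 X] [CompleteSpace X]

/-- The operator `H` is dual to `f ↦ ∑ R_i† ∘ f ∘ ω_i`. -/
theorem integ_markov (μ : Cabv 𝕜 T X) {f : T → X} (hf : Continuous f) :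
    integ f (markov ω hω R μ) = integ (fun t => ∑ i, (R i).adjoint (f (ω i t))) μ := by
  obtain ⟨C, hC⟩ := exists_bound hf
  have hg (i : Fin M) : Continuous fun t => (R i).adjoint (f t) :=
    (R i).adjoint.continuous.comp hf
  have hi (i : Fin M) : integ f (push (R i) (transport ⟨ω i, (hω i).continuous⟩ μ))
      = integ (fun t => (R i).adjoint (f (ω i t))) μ := by
    rw [integ_push _ _ hf.stronglyMeasurable hC,
      integ_transport _ _ (hg i).stronglyMeasurable (exists_bound (hg i))]
    rfl
  rw [markov, integ_sum_measure _ _ fun i => integrable_of_continuous hf _,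
    Finset.sum_congr rfl fun i _ => hi i]
  exact (VectorMeasure.integral_finsetSum Finset.univ fun i _ =>
    integrable_of_continuous ((hg i).comp (hω i).continuous) μ).symm

theorem dMKStar_markov_le {μ ν : Cabv 𝕜 T X} (h : μ.1 univ = ν.1 univ) :
    dMKStar (markov ω hω R μ) (markov ω hω R ν)
      ≤ ENNReal.ofReal (∑ i, ‖R i‖ * lip (ω i)) * dMKStar μ ν := by
  refine iSup₂_le fun f hf => ?_
  have hf : LipschitzWith 1 f := eLip_le_iff.1 hf
  let g : T → X := fun t => ∑ i, (R i).adjoint (f (ω i t))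
  have hg : LipschitzWith (∑ i, ‖R i‖₊ * (eLip (ω i)).toNNReal) g := by
    refine LipschitzWith.of_dist_le_mul fun s t => ?_
    rw [NNReal.coe_sum, Finset.sum_mul]
    refine dist_sum_sum_le_of_le _ fun i _ => ?_
    have := (R i).adjoint.lipschitz.comp (hf.comp (hω i).lipschitzWith)
    rw [one_mul, LinearIsometryEquiv.nnnorm_map] at this
    exact this.dist_le_mul s t
  rw [integ_sub_measure (integrable_of_continuous hf.continuous _)
    (integrable_of_continuous hf.continuous _), integ_markov _ hf.continuous,
    integ_markov _ hf.continuous, ← integ_sub_measure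
    (integrable_of_continuous hg.continuous μ) (integrable_of_continuous hg.continuous ν)]
  refine (enorm_integ_le_mul_mkStar (by simp [h]) hg).trans_eq ?_
  congr 1
  rw [← ENNReal.ofReal_coe_nnreal]
  simp [lip, ENNReal.coe_toNNReal_eq_toReal]

end markov

variable [CompactSpace T] [NormedSpace ℝ X] [IsScalarTower ℝ 𝕜 X]

theorem isClosed_ball (a : ℝ) (v : X) :
    IsClosed[weakStar 𝕜 T X] (ball a v : Set (Cabv 𝕜 T X)) := by
  let _ := weakStar 𝕜 T X
  have hind : Continuous fun (μ : Cabv 𝕜 T X) (f : C(T, X)) => integ f μ := continuous_induced_dom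
  have hcont (f : C(T, X)) : Continuous fun μ : Cabv 𝕜 T X => integ f μ :=
    continuous_pi_iff.1 hind f
  have h : (ball a v : Set (Cabv 𝕜 T X))
      = (⋂ (f : C(T, X)) (_ : ∀ t, ‖f t‖ ≤ 1), {μ | ‖integ f μ‖ ≤ a})
        ∩ ⋂ x : X, {μ | integ (ContinuousMap.const T x) μ = inner 𝕜 v x} := by
    ext μ
    simp only [ball, mem_ofPred_eq, mem_inter_iff, mem_iInter]
    refine and_congr ⟨fun h f hf => ?_, varNorm_le_of_forall_continuous⟩ ⟨fun h x => ?_, fun h => ?_⟩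
    · simpa using (norm_integ_le_of_bound μ hf).trans (by simpa using h)
    · rw [← h]
      exact integ_const μ x
    · exact ext_inner_right 𝕜 fun x => (integ_const μ x).symm.trans (h x)
  rw [h]
  exact (isClosed_biInter fun f _ => isClosed_le (hcont f).norm continuous_const).inter
    (isClosed_iInter fun x => isClosed_eq (hcont _) continuous_const)

section metric

variable {A : Set (Cabv 𝕜 T X)} {v : X}

/-- The metric `d*_MK` on a set of measures having the same total mass `v`. -/
@[reducible] noncomputable def mkMetricSpace (hA : ∀ μ ∈ A, μ.1 univ = v) : MetricSpace A :=
  letI : EMetricSpace A :=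
    { edist := fun μ ν => dMKStar μ.1 ν.1
      edist_self := fun μ => by simp [dMKStar, mkStar, integ]
      edist_comm := fun μ ν => by
        refine iSup_congr fun f => iSup_congr fun _ => ?_
        rw [← enorm_neg, integ, integ, ← VectorMeasure.integral_neg_vectorMeasure]
        congr 2
        simp
      edist_triangle := fun μ ν ρ => iSup₂_le fun f hf => by
        have hi := integrable_of_continuous (𝕜 := 𝕜) (eLip_le_iff (K := 1).1 hf).continuous
        have h : integ f (μ.1 - ρ.1) = integ f (μ.1 - ν.1) + integ f (ν.1 - ρ.1) := by
          simp only [integ_sub_measure (hi _) (hi _)]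
          abel
        rw [h]
        exact (enorm_add_le _ _).trans
          (add_le_add (le_iSup₂_of_le f hf le_rfl) (le_iSup₂_of_le f hf le_rfl))
      eq_of_edist_eq_zero := fun {μ ν} h => Subtype.ext <| sub_eq_zero.1 <|
        eq_zero_of_mkStar_eq_zero (by simp [hA _ μ.2, hA _ ν.2]) h }
  EMetricSpace.toMetricSpace fun μ ν =>
    ((mkStar_le_of_univ_eq_zero (by simp [hA _ μ.2, hA _ ν.2])).trans_lt
      ENNReal.ofReal_lt_top).ne

/-- A bounded weak* closed set is complete for `d*_MK`: the weak* limit of a Cauchy sequence along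
an ultrafilter is its limit for `d*_MK`, by lower semicontinuity of the norm. -/
theorem completeSpace_mkMetricSpace [CompleteSpace X] (hA : ∀ μ ∈ A, μ.1 univ = v) {a : ℝ}
    (ha : ∀ μ ∈ A, varNorm μ ≤ a) (hcl : IsClosed[weakStar 𝕜 T X] A) :
    @CompleteSpace A (mkMetricSpace hA).toUniformSpace := by
  let _ := mkMetricSpace hA
  refine Metric.complete_of_cauchySeq_tendsto fun u hu => ?_
  obtain ⟨μ, hμ⟩ := exists_tendsto_integ (hyperfilter ℕ) (fun k => (u k).1) fun k => ha _ (u k).2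
  have hμA : μ ∈ A := by
    let _ := weakStar 𝕜 T X
    refine hcl.mem_of_tendsto (b := (hyperfilter ℕ : Filter ℕ)) (f := fun k => (u k).1) ?_
      (.of_forall fun k => (u k).2)
    rw [nhds_induced, tendsto_comap_iff]
    exact tendsto_pi_nhds.2 hμ
  refine ⟨⟨μ, hμA⟩, EMetric.tendsto_atTop.2 fun ε hε => ?_⟩
  obtain ⟨δ, hδ0, hδ⟩ := exists_between hε
  obtain ⟨N, hN⟩ := EMetric.cauchySeq_iff.1 hu δ hδ0
  refine ⟨N, fun k hk => lt_of_le_of_lt (iSup₂_le fun f hf => ?_) hδ⟩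
  have hfc := (eLip_le_iff (K := 1).1 hf).continuous
  have hlim : Tendsto (fun m => integ f ((u k).1 - (u m).1)) (hyperfilter ℕ)
      (𝓝 (integ f ((u k).1 - μ))) := by
    simp only [integ_sub_measure (integrable_of_continuous hfc _) (integrable_of_continuous hfc _)]
    exact tendsto_const_nhds.sub (hμ ⟨f, hfc⟩)
  refine le_of_tendsto hlim.enorm (Nat.hyperfilter_le_atTop ?_)
  filter_upwards [eventually_ge_atTop N] with m hm
  exact (le_iSup₂ (f := fun (f : T → X) (_ : eLip f ≤ 1) =>
    ‖integ f ((u k).1 - (u m).1)‖ₑ) f hf).trans (hN k hk m hm).le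

end metric

end

end FractalVM

theorem theorem2p2p1 {𝕜 : Type*} [RCLike 𝕜]
    {T : Type*} [MetricSpace T] [CompactSpace T] [Nonempty T] [MeasurableSpace T] [BorelSpace T]
    {n : ℕ} (hn : 1 ≤ n) {M : ℕ} (hM : 1 ≤ M)
    (ω : Fin M → T → T) (hω : ∀ i, FractalVM.IsLip (ω i))
    (R : Fin M → EuclideanSpace 𝕜 (Fin n) →L[𝕜] EuclideanSpace 𝕜 (Fin n))
    (hR : ∑ i, R i = ContinuousLinearMap.id 𝕜 (EuclideanSpace 𝕜 (Fin n)))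
    (c : ℝ) (hc : c = ∑ i, ‖R i‖ * FractalVM.lip (ω i)) :
    -- the main assertion
    (c < 1 →
      ∀ (a : ℝ) (v : EuclideanSpace 𝕜 (Fin n)), 0 < a → ‖v‖ ≤ a →
      ∀ A : Set (FractalVM.Cabv 𝕜 T (EuclideanSpace 𝕜 (Fin n))),
        A.Nonempty → A ⊆ FractalVM.ball a v →
        IsClosed[FractalVM.weakStar 𝕜 T (EuclideanSpace 𝕜 (Fin n))] A →
        ∀ hA : MapsTo (FractalVM.markov ω hω R) A A,
          (∃ _m : MetricSpace A,
            (∀ μ ν : A, edist μ ν = FractalVM.dMKStar μ.1 ν.1) ∧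
            FractalVM.eLip (hA.restrict (FractalVM.markov ω hω R) A A) ≤ ENNReal.ofReal c) ∧
          ∃! μ : A, hA.restrict (FractalVM.markov ω hω R) A A μ = μ) ∧
    -- the particular cases
    ((∀ i, FractalVM.lip (ω i) < 1) → ∑ i, ‖R i‖ = 1 → c < 1) ∧
    ((∀ μ : FractalVM.Cabv 𝕜 T (EuclideanSpace 𝕜 (Fin n)),
        FractalVM.varNorm (FractalVM.markov ω hω R μ) ≤ FractalVM.varNorm μ) →
      ∀ (a : ℝ) (v : EuclideanSpace 𝕜 (Fin n)), 0 < a → ‖v‖ ≤ a →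
        (FractalVM.ball a v : Set (FractalVM.Cabv 𝕜 T (EuclideanSpace 𝕜 (Fin n)))).Nonempty ∧
        IsClosed[FractalVM.weakStar 𝕜 T (EuclideanSpace 𝕜 (Fin n))] (FractalVM.ball a v) ∧
        MapsTo (FractalVM.markov ω hω R) (FractalVM.ball a v) (FractalVM.ball a v)) ∧
    (∑ i, ‖R i‖ = 1 →
      ∀ μ : FractalVM.Cabv 𝕜 T (EuclideanSpace 𝕜 (Fin n)),
        FractalVM.varNorm (FractalVM.markov ω hω R μ) ≤ FractalVM.varNorm μ) := by
  refine ⟨fun hc1 a v ha hv A hne hAB hcl hA => ?_, fun hr hR1 => ?_, fun hH a v ha hv => ?_,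
    fun hR1 μ => ?_⟩
  · have hAv : ∀ μ ∈ A, μ.1 univ = v := fun μ hμ => (hAB hμ).2
    let _ := FractalVM.mkMetricSpace hAv
    have : CompleteSpace A :=
      FractalVM.completeSpace_mkMetricSpace hAv (fun μ hμ => (hAB hμ).1) hcl
    have : Nonempty A := hne.to_subtype
    have hL : LipschitzWith c.toNNReal (hA.restrict (FractalVM.markov ω hω R) A A) := fun μ ν => by
      subst hc
      exact FractalVM.dMKStar_markov_le (hω := hω) (R := R) ((hAv _ μ.2).trans (hAv _ ν.2).symm)
    have hK : ContractingWith c.toNNReal (hA.restrict (FractalVM.markov ω hω R) A A) :=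
      ⟨by simpa using hc1, hL⟩
    exact ⟨⟨FractalVM.mkMetricSpace hAv, fun _ _ => rfl, FractalVM.eLip_le_iff.2 hL⟩,
      _, hK.fixedPoint_isFixedPt, fun μ hμ => hK.fixedPoint_unique hμ⟩
  · rw [hc, ← hR1]
    -- Strictness needs one index with `‖R i‖ ≠ 0`, which the sum being `1` provides.
    obtain ⟨i, -, hi⟩ := Finset.exists_ne_zero_of_sum_ne_zero (hR1.trans_ne one_ne_zero)
    refine Finset.sum_lt_sum (fun j _ => mul_le_of_le_one_right (norm_nonneg _) (hr j).le)
      ⟨i, Finset.mem_univ i, mul_lt_of_lt_one_right ((norm_nonneg _).lt_of_ne' hi) (hr i)⟩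
  · refine ⟨FractalVM.nonempty_ball hv, FractalVM.isClosed_ball a v, fun μ hμ =>
      ⟨(hH μ).trans hμ.1, ?_⟩⟩
    -- The total mass is preserved because `∑ R i` is the identity.
    rw [FractalVM.markov_apply μ MeasurableSet.univ]
    simp only [preimage_univ, hμ.2, ← sum_apply, hR]
    rfl
  · simpa [hR1] using FractalVM.varNorm_markov_le (hω := hω) (R := R) μ
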